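/- Let $U\subset\mathbb R$ be open, let $\hat I=\hat I_1\cup\dots\cup\hat I_m\subset U$ be a finite union of pairwise disjoint non-degenerate compact intervals, and let $f:U\to\mathbb R$ be a $C^2$ map which is non-flat at each of its critical points: if $f'(c)=0$, then near $c$ one has $f(x)=f(c)\pm|\varphi(x)|^{d}$ for some $d>1$ and some local $C^2$ diffeomorphism $\varphi$ with $\varphi(c)=0$, where the sign may depend on the side of $c$. Let $K=\{x\in\hat I: f^n(x)\in\hat I\text{ for all }n\ge 0\}$ be the maximal forward invariant subset of $\hat I$. Assume that $\partial\hat I\subset K$, that $f|_K$ is topologically transitive, and that $f|_K$ has positive topological entropy. (This is what $(f,K)\in\mathcal A_+$ means.) Assume that $K$ is weakly isolated: there is $\varepsilon>0$ such that every periodic orbit of $f$ contained in $U\cap B(K,\varepsilon)$ is contained in $K$. Let $\Sigma$ be the set of turning critical points of $f$ in $K$, i.e. of the critical points in $K$ at which $f$ is not locally injective. Call a nonempty set $E\subset K$ weakly $\Sigma$-exceptional if $E$ is not dense in $K$ and $(f|_K)^{-1}(E)\setminus\Sigma\subset E$, and call a point weakly $\Sigma$-exceptional if it belongs to such a set. Then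 there is $\delta>0$, depending only on $f,K,\hat I,U$, such that the following holds. Let $W\subset U$ be an interval (open, closed or half-closed) of length less than $\delta$, on which $f$ is monotone, with $\overline W\cap K\ne\emptyset$, and such that $\overline W$ contains no point of $\partial\hat I$ that is weakly $\Sigma$-exceptional. Then $f|_W$ is a $K$-homeomorphism: $f|_W$ is a homeomorphism onto $f(W)$, and $f(W\cap K)=f(W)\cap K$. -/

import Mathlib

open Set Filter Topology

/-- `c` is a critical point of `f`, regarded as a map on the open set `U`. -/
def IsCritPt (f : ℝ → ℝ) (U : Set ℝ) (c : ℝ) : Prop :=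
  c ∈ U ∧ deriv f c = 0

/-- A turning critical point: a critical point at which `f` is not locally injective
(the other critical points are the inflection ones). -/
def IsTurningPt (f : ℝ → ℝ) (U : Set ℝ) (c : ℝ) : Prop :=
  IsCritPt f U c ∧ ∀ V ∈ 𝓝 c, ¬ InjOn f V

/-- Non-flatness at `c`: near `c` one has `f x = f c ± |φ x| ^ d`, where `d > 1` and `φ` is a
`C²` diffeomorphism near `c` with `φ c = 0` (the sign may depend on the side of `c`). -/
def IsNonFlatAt (f : ℝ → ℝ) (c : ℝ) : Prop :=
  ∃ (d : ℝ) (φ : ℝ → ℝ), 1 < d ∧ ContDiffAt ℝ 2 φ c ∧ φ c = 0 ∧ deriv φ c ≠ 0 ∧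
    ∀ᶠ x in 𝓝 c, |f x - f c| = |φ x| ^ d

/-- Topological transitivity of `f` restricted to `K`. -/
def TransitiveOn (f : ℝ → ℝ) (K : Set ℝ) : Prop :=
  ∀ V W : Set ℝ, IsOpen V → IsOpen W → (V ∩ K).Nonempty → (W ∩ K).Nonempty →
    ∃ n : ℕ, ((f^[n] '' (V ∩ K)) ∩ W).Nonempty

/-- The generalized multimodal quadruples `(f, K, I, U)` of positive topological entropy.
The map is defined on the open set `U`; the values of `f` off `U` play no role. -/
structure IsMultimodalPos (f : ℝ → ℝ) (K I U : Set ℝ) : Prop where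
  isOpen_dom : IsOpen U
  subset_dom : I ⊆ U
  contDiffOn : ContDiffOn ℝ 2 f U
  nonFlat : ∀ c, IsCritPt f U c → IsNonFlatAt f c
  /-- `I` is a finite union of pairwise disjoint closed intervals with ends in `K`. -/
  exists_intervals : ∃ (m : ℕ) (a b : Fin m → ℝ), (∀ j, a j < b j) ∧
    Pairwise (fun i j => Disjoint (Icc (a i) (b i)) (Icc (a j) (b j))) ∧
    I = ⋃ j, Icc (a j) (b j) ∧ ∀ j, a j ∈ K ∧ b j ∈ K
  /-- `K` is the maximal forward invariant subset of `I`. -/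
  maximal : K = {x | ∀ n : ℕ, f^[n] x ∈ I}
  transitive : TransitiveOn f K
  entropy_pos : 0 < Dynamics.coverEntropy f K

/-- Weak isolation: every periodic orbit of `f` (staying in the domain `U`) that lies in some
fixed neighbourhood `B(K, ε)` of `K` is contained in `K`. -/
def WeaklyIsolated (f : ℝ → ℝ) (K U : Set ℝ) : Prop :=
  ∃ ε > 0, ∀ (p : ℝ) (n : ℕ), 0 < n → f^[n] p = p →
    (∀ i : ℕ, f^[i] p ∈ U ∩ Metric.thickening ε K) → ∀ i : ℕ, f^[i] p ∈ K

/-- `E` is a weakly `S`-exceptional subset of `K`: nonempty, not dense in `K`, and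
`(f|_K)⁻¹(E) \ S ⊆ E`. -/
def IsWeaklyExceptionalSet (f : ℝ → ℝ) (K S E : Set ℝ) : Prop :=
  E.Nonempty ∧ E ⊆ K ∧ ¬ K ⊆ closure E ∧ (K ∩ f ⁻¹' E) \ S ⊆ E

/-- A weakly `S`-exceptional point. -/
def IsWeaklyExceptional (f : ℝ → ℝ) (K S : Set ℝ) (x : ℝ) : Prop :=
  ∃ E, IsWeaklyExceptionalSet f K S E ∧ x ∈ E

/-- `f|_W` is a `K`-homeomorphism: it is a homeomorphism onto its image and
`f(W ∩ K) = f(W) ∩ K`. -/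
def IsKHomeo (f : ℝ → ℝ) (K W : Set ℝ) : Prop :=
  Topology.IsEmbedding (W.domRestrict f) ∧ f '' (W ∩ K) = f '' W ∩ K

/-! Only points outside `I` can fail: if `x ∈ W \ K` and `f x ∈ K`, then `x ∉ I`, and on the way
from `K` to `x` one leaves `I` at an end `a`. So it suffices that, for `x` close to a
non-exceptional end `a` with the gap between them free of `I`, `f x` is never in `K`
(`exists_forall_map_notMem`).

Suppose it is in `K` for `x` arbitrarily close to `a`. Take a short segment in the gap starting at
`a` and pull it back along backward orbits of `a` in `K` avoiding turning points. The points reached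
form a set closed under non-turning preimages, so it is dense in `K`, `a` being non-exceptional.
Hence some pullback starts strictly between `f a` and `f x`; it meets `K` only at its start, so it
cannot cross these two points of `K`. Lifting it once more gives a segment between `a` and `x` that
an iterate stretches over itself. This yields a periodic point in the gap whose orbit stays near
`K`, against weak isolation.

One length of segment must serve for all backward orbits. At all but finitely many points of `K`,
neighbours in `K` on both sides make any pullback lift whatever its size; the finitely many others
only require the initial segment to be short enough. -/

/-- The segment from `y` to `w` is carried by `f^[k]` to the one from `a` to `v`, its images stay
`ε`-close to `K`, and it meets `K` only at `y`. -/
def IsPullback (f : ℝ → ℝ) (K : Set ℝ) (ε a v : ℝ) (k : ℕ) (y w : ℝ) : Prop :=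
  f^[k] y = a ∧ f^[k] w = v ∧ ContinuousOn f^[k] (uIcc y w) ∧
    (∀ z ∈ uIcc y w, ∀ i ≤ k, f^[i] z ∈ Metric.thickening ε K) ∧ ∀ z ∈ uIcc y w, z ∈ K → z = y

/-! ### Lifting segments by one step of the map -/

theorem mapsTo_uIcc_of_injOn {f : ℝ → ℝ} {y w : ℝ} (hc : ContinuousOn f (uIcc y w))
    (hi : InjOn f (uIcc y w)) : MapsTo f (uIcc y w) (uIcc (f y) (f w)) := by
  have key : ∀ {p q : ℝ}, p ≤ q → ContinuousOn f (Icc p q) → InjOn f (Icc p q) →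
      MapsTo f (Icc p q) (uIcc (f p) (f q)) := by
    intro p q hpq hc hi
    rcases hc.strictMonoOn_of_injOn_Icc' hpq hi with h | h
    · exact h.monotoneOn.mapsTo_Icc.mono_right Icc_subset_uIcc
    · exact h.antitoneOn.mapsTo_Icc.mono_right Icc_subset_uIcc'
  rcases le_total y w with h | h
  · rw [uIcc_of_le h] at *
    exact key h hc hi
  · rw [uIcc_of_ge h] at *
    rw [uIcc_comm]
    exact key h hc hi

theorem mem_thickening_of_mem_uIcc {K : Set ℝ} {ε y w z : ℝ} (hy : y ∈ K) (hw : |w - y| < ε)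
    (hz : z ∈ uIcc y w) : z ∈ Metric.thickening ε K := by
  rw [Metric.mem_thickening_iff]
  refine ⟨y, hy, ?_⟩
  rw [Real.dist_eq]
  have := abs_sub_left_of_mem_uIcc hz
  linarith

/-- A point of `K` on the lifted segment goes to a point of `K` on the old one, hence to `f y`, and
injectivity makes it `y`. -/
theorem IsPullback.step {f : ℝ → ℝ} {K : Set ℝ} {ε a v : ℝ} {k : ℕ} {y w : ℝ}
    (hK : MapsTo f K K) (h : IsPullback f K ε a v k (f y) (f w)) (hy : y ∈ K)
    (hw : |w - y| < ε) (hc : ContinuousOn f (uIcc y w)) (hi : InjOn f (uIcc y w)) :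
    IsPullback f K ε a v (k + 1) y w := by
  obtain ⟨h1, h2, h3, h4, h5⟩ := h
  have hm := mapsTo_uIcc_of_injOn hc hi
  refine ⟨h1, h2, ?_, ?_, ?_⟩
  · rw [Function.iterate_succ]
    exact h3.comp hc hm
  · intro z hz i hik
    cases i with
    | zero => exact mem_thickening_of_mem_uIcc hy hw hz
    | succ i => exact h4 (f z) (hm hz) i (by omega)
  · intro z hz hzK
    exact hi hz left_mem_uIcc (h5 _ (hm hz) (hK hzK))

theorem IsPullback.refl {f : ℝ → ℝ} {K : Set ℝ} {ε a v : ℝ} (ha : a ∈ K) (hv : |v - a| < ε)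
    (h : ∀ z ∈ uIcc a v, z ∈ K → z = a) : IsPullback f K ε a v 0 a v := by
  refine ⟨rfl, rfl, continuousOn_id, ?_, h⟩
  intro z hz i hi
  obtain rfl : i = 0 := by omega
  exact mem_thickening_of_mem_uIcc ha hv hz

/-- If `f` is injective on both sides of `y`, and near `y`, then one of the sides is mapped over
any short segment starting at `f y`. -/
theorem exists_preimage_segment {f : ℝ → ℝ} {y p q w' : ℝ} {V : Set ℝ} (hp : p < y) (hq : y < q)
    (hc : ContinuousOn f (Icc p q)) (hip : InjOn f (Icc p y)) (hiq : InjOn f (Icc y q))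
    (hV : V ∈ 𝓝 y) (hiV : InjOn f V) (hwp : f p ∉ uIcc (f y) w') (hwq : f q ∉ uIcc (f y) w') :
    ∃ w ∈ Icc p q, f w = w' ∧ InjOn f (uIcc y w) := by
  have hcp : ContinuousOn f (Icc p y) := hc.mono (Icc_subset_Icc_right hq.le)
  have hcq : ContinuousOn f (Icc y q) := hc.mono (Icc_subset_Icc_left hp.le)
  have left : w' ∈ uIcc (f p) (f y) → ∃ w ∈ Icc p q, f w = w' ∧ InjOn f (uIcc y w) := by
    intro h
    rw [← uIcc_of_le hp.le] at hcp
    obtain ⟨w, hw, rfl⟩ := intermediate_value_uIcc hcp h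
    rw [uIcc_of_le hp.le] at hw
    refine ⟨w, ⟨hw.1, hw.2.trans hq.le⟩, rfl, ?_⟩
    rw [uIcc_of_ge hw.2]
    exact hip.mono (Icc_subset_Icc_left hw.1)
  have right : w' ∈ uIcc (f y) (f q) → ∃ w ∈ Icc p q, f w = w' ∧ InjOn f (uIcc y w) := by
    intro h
    rw [← uIcc_of_le hq.le] at hcq
    obtain ⟨w, hw, rfl⟩ := intermediate_value_uIcc hcq h
    rw [uIcc_of_le hq.le] at hw
    refine ⟨w, ⟨hp.le.trans hw.1, hw.2⟩, rfl, ?_⟩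
    rw [uIcc_of_le hw.1]
    exact hiq.mono (Icc_subset_Icc_right hw.2)
  -- the two sides are mapped to opposite sides of `f y`
  obtain ⟨u, v, ⟨hu, hv⟩, huv⟩ : ∃ u v, y ∈ Ioo u v ∧ Ioo u v ⊆ V :=
    mem_nhds_iff_exists_Ioo_subset.1 hV
  obtain ⟨u₁, hu₁, hu₁'⟩ := exists_between (max_lt hu hp)
  obtain ⟨v₁, hv₁, hv₁'⟩ := exists_between (lt_min hv hq)
  rw [max_lt_iff] at hu₁
  rw [lt_min_iff] at hv₁'
  have hmem : ∀ z ∈ Icc u₁ v₁, z ∈ V := fun z hz =>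
    huv ⟨hu₁.1.trans_le hz.1, hz.2.trans_lt hv₁'.1⟩
  have hcm : ContinuousOn f (Icc u₁ v₁) := hc.mono (Icc_subset_Icc hu₁.2.le hv₁'.2.le)
  have hmono := hcm.strictMonoOn_of_injOn_Icc' (hu₁'.trans hv₁).le (hiV.mono hmem)
  have hyI : y ∈ Icc u₁ v₁ := ⟨hu₁'.le, hv₁.le⟩
  have huI : u₁ ∈ Icc u₁ v₁ := ⟨le_rfl, (hu₁'.trans hv₁).le⟩
  have hvI : v₁ ∈ Icc u₁ v₁ := ⟨(hu₁'.trans hv₁).le, le_rfl⟩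
  have hup : u₁ ∈ Icc p y := ⟨hu₁.2.le, hu₁'.le⟩
  have hvq : v₁ ∈ Icc y q := ⟨hv₁.le, hv₁'.2.le⟩
  have hpp : p ∈ Icc p y := left_mem_Icc.2 hp.le
  have hyp : y ∈ Icc p y := right_mem_Icc.2 hp.le
  have hqq : q ∈ Icc y q := right_mem_Icc.2 hq.le
  have hyq : y ∈ Icc y q := left_mem_Icc.2 hq.le
  -- Opposite directions of monotonicity on the two sides would fold `f` at `y`, against injectivity
  -- on `V`.
  have hopp : (f p < f y ∧ f y < f q) ∨ (f q < f y ∧ f y < f p) := by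
    rcases hcp.strictMonoOn_of_injOn_Icc' hp.le hip with A | A <;>
    rcases hcq.strictMonoOn_of_injOn_Icc' hq.le hiq with B | B
    · exact Or.inl ⟨A hpp hyp hp, B hyq hqq hq⟩
    · exfalso
      have a1 := A hup hyp hu₁'
      have b1 := B hyq hvq hv₁
      rcases hmono with C | C
      · linarith [C hyI hvI hv₁]
      · linarith [C huI hyI hu₁']
    · exfalso
      have a1 := A hup hyp hu₁'
      have b1 := B hyq hvq hv₁
      rcases hmono with C | C
      · linarith [C huI hyI hu₁']
      · linarith [C hyI hvI hv₁]
    · exact Or.inr ⟨B hyq hqq hq, A hpp hyp hp⟩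
  rw [mem_uIcc] at hwp hwq
  simp only [not_or, not_and, not_le] at hwp hwq
  rcases le_total (f y) w' with h | h <;> rcases hopp with ⟨h1, h2⟩ | ⟨h1, h2⟩
  · exact right (mem_uIcc.2 (Or.inl ⟨h, (hwq.1 h2.le).le⟩))
  · exact left (mem_uIcc.2 (Or.inr ⟨h, (hwp.1 h2.le).le⟩))
  · exact left (mem_uIcc.2 (Or.inl ⟨not_lt.1 fun hh => absurd (hwp.2 hh.le) h1.not_gt, h⟩))
  · exact right (mem_uIcc.2 (Or.inr ⟨not_lt.1 fun hh => absurd (hwq.2 hh.le) h1.not_gt, h⟩))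

/-! ### One-sided injectivity from non-flatness -/

theorem exists_nhds_injOn_of_deriv_ne_zero {g : ℝ → ℝ} {c : ℝ} (hg : ContDiffAt ℝ 2 g c)
    (h : deriv g c ≠ 0) : ∃ V ∈ 𝓝 c, InjOn g V := by
  have hs : HasStrictDerivAt g (deriv g c) c := hg.hasStrictDerivAt (by norm_num)
  have hs' := hs.hasStrictFDerivAt_equiv h
  exact ⟨_, (hs'.toOpenPartialHomeomorph g).open_source.mem_nhds
    hs'.mem_toOpenPartialHomeomorph_source, (hs'.toOpenPartialHomeomorph g).injOn⟩

theorem abs_injOn_of_strictMonoOn {φ : ℝ → ℝ} {S : Set ℝ} {c : ℝ} (hc : c ∈ S)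
    (hcS : c ∈ lowerBounds S ∨ c ∈ upperBounds S) (h0 : φ c = 0)
    (h : StrictMonoOn φ S ∨ StrictAntiOn φ S) : InjOn (fun x => |φ x|) S := by
  have hinj : InjOn φ S := h.elim StrictMonoOn.injOn StrictAntiOn.injOn
  have hsign : (∀ x ∈ S, 0 ≤ φ x) ∨ ∀ x ∈ S, φ x ≤ 0 := by
    rw [← h0]
    rcases h with h | h <;> rcases hcS with hcS | hcS
    · exact Or.inl fun x hx => h.monotoneOn hc hx (hcS hx)
    · exact Or.inr fun x hx => h.monotoneOn hx hc (hcS hx)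
    · exact Or.inr fun x hx => h.antitoneOn hc hx (hcS hx)
    · exact Or.inl fun x hx => h.antitoneOn hx hc (hcS hx)
  intro x hx y hy hxy
  simp only at hxy
  apply hinj hx hy
  rcases hsign with hs | hs
  · rwa [abs_of_nonneg (hs x hx), abs_of_nonneg (hs y hy)] at hxy
  · rw [abs_of_nonpos (hs x hx), abs_of_nonpos (hs y hy)] at hxy
    linarith

namespace IsMultimodalPos

variable {f : ℝ → ℝ} {K I U : Set ℝ}

theorem contDiffAt (hf : IsMultimodalPos f K I U) {c : ℝ} (hc : c ∈ U) : ContDiffAt ℝ 2 f c :=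
  hf.contDiffOn.contDiffAt (hf.isOpen_dom.mem_nhds hc)

/-- At a critical point, `|f x - f c|` is a power of `|φ x|`, and `φ` is strictly monotone and of
one sign on each side of `c`. -/
theorem exists_injOn_sides (hf : IsMultimodalPos f K I U) {c : ℝ} (hc : c ∈ U) :
    ∃ η > 0, Icc (c - η) (c + η) ⊆ U ∧ InjOn f (Icc (c - η) c) ∧ InjOn f (Icc c (c + η)) := by
  have hU := hf.isOpen_dom.mem_nhds hc
  by_cases hd : deriv f c = 0
  · obtain ⟨d, φ, hd1, hφ, hφ0, hφ', hev⟩ := hf.nonFlat c ⟨hc, hd⟩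
    obtain ⟨V, hV, hVi⟩ := exists_nhds_injOn_of_deriv_ne_zero hφ hφ'
    have hcont : ∀ᶠ x in 𝓝 c, ContinuousAt φ x :=
      (hφ.eventually (by norm_num)).mono fun x hx => hx.continuousAt
    obtain ⟨η, hη, hb⟩ := Metric.nhds_basis_closedBall.mem_iff.1
      (inter_mem (inter_mem hU hV) (inter_mem hev hcont))
    rw [Real.closedBall_eq_Icc] at hb
    have hl : Icc (c - η) c ⊆ Icc (c - η) (c + η) := Icc_subset_Icc_right (by linarith)
    have hr : Icc c (c + η) ⊆ Icc (c - η) (c + η) := Icc_subset_Icc_left (by linarith)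
    have key : ∀ S ⊆ Icc (c - η) (c + η), InjOn (fun x => |φ x|) S → InjOn f S := by
      intro S hS hi x hx y hy hxy
      apply hi hx hy
      have ex : |f x - f c| = |φ x| ^ d := (hb (hS hx)).2.1
      have ey : |f y - f c| = |φ y| ^ d := (hb (hS hy)).2.1
      rw [hxy, ey] at ex
      exact Real.rpow_left_injOn (x := d) (by linarith) (abs_nonneg (φ x)) (abs_nonneg (φ y)) ex.symm
    have hco : ContinuousOn φ (Icc (c - η) (c + η)) := fun x hx =>
      ContinuousAt.continuousWithinAt (hb hx).2.2
    have hin : InjOn φ (Icc (c - η) (c + η)) := hVi.mono fun x hx => (hb hx).1.2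
    refine ⟨η, hη, fun x hx => (hb hx).1.1, key _ hl ?_, key _ hr ?_⟩
    · exact abs_injOn_of_strictMonoOn (right_mem_Icc.2 (by linarith)) (Or.inr fun x hx => hx.2) hφ0
        ((hco.mono hl).strictMonoOn_of_injOn_Icc' (by linarith) (hin.mono hl))
    · exact abs_injOn_of_strictMonoOn (left_mem_Icc.2 (by linarith)) (Or.inl fun x hx => hx.1) hφ0
        ((hco.mono hr).strictMonoOn_of_injOn_Icc' (by linarith) (hin.mono hr))
  · obtain ⟨V, hV, hVi⟩ := exists_nhds_injOn_of_deriv_ne_zero (hf.contDiffAt hc) hd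
    obtain ⟨η, hη, hb⟩ := Metric.nhds_basis_closedBall.mem_iff.1 (inter_mem hU hV)
    rw [Real.closedBall_eq_Icc] at hb
    have hi : InjOn f (Icc (c - η) (c + η)) := hVi.mono fun x hx => (hb hx).2
    exact ⟨η, hη, fun x hx => (hb hx).1, hi.mono (Icc_subset_Icc_right (by linarith)),
      hi.mono (Icc_subset_Icc_left (by linarith))⟩

/-! ### Invariance and compactness of `K` -/

theorem continuousOn (hf : IsMultimodalPos f K I U) : ContinuousOn f U := hf.contDiffOn.continuousOn

theorem subset (hf : IsMultimodalPos f K I U) : K ⊆ I := by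
  intro x hx
  rw [hf.maximal] at hx
  exact hx 0

theorem subset_dom' (hf : IsMultimodalPos f K I U) : K ⊆ U := hf.subset.trans hf.subset_dom

theorem mapsTo (hf : IsMultimodalPos f K I U) : MapsTo f K K := by
  intro x hx
  rw [hf.maximal] at hx ⊢
  exact fun n => hx (n + 1)

theorem mem_of_mem_of_map_mem (hf : IsMultimodalPos f K I U) {x : ℝ} (hx : x ∈ I)
    (hfx : f x ∈ K) : x ∈ K := by
  rw [hf.maximal] at hfx ⊢
  intro n
  cases n with
  | zero => exact hx
  | succ n => exact hfx n

theorem isCompact_intervals (hf : IsMultimodalPos f K I U) : IsCompact I := by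
  obtain ⟨m, a, b, -, -, rfl, -⟩ := hf.exists_intervals
  exact isCompact_iUnion fun j => isCompact_Icc

theorem isCompact (hf : IsMultimodalPos f K I U) : IsCompact K := by
  refine hf.isCompact_intervals.of_isClosed_subset (IsSeqClosed.isClosed ?_) hf.subset
  intro u x hu hx
  have hu' : ∀ j n, f^[n] (u j) ∈ I := fun j => by
    have := hu j
    rw [hf.maximal] at this
    exact this
  have hcl := hf.isCompact_intervals.isClosed
  -- Continuity of `f` is known only on `U`, so each limit iterate must be placed in `I` before the
  -- next one is taken.
  have key : ∀ n, Tendsto (fun j => f^[n] (u j)) atTop (𝓝 (f^[n] x)) := by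
    intro n
    induction n with
    | zero => exact hx
    | succ n ih =>
      have hm : f^[n] x ∈ I := hcl.mem_of_tendsto ih (Eventually.of_forall fun j => hu' j n)
      have hcf : ContinuousAt f (f^[n] x) := (hf.contDiffAt (hf.subset_dom hm)).continuousAt
      simp only [Function.iterate_succ_apply']
      exact hcf.tendsto.comp ih
  rw [hf.maximal]
  exact fun n => hcl.mem_of_tendsto (key n) (Eventually.of_forall fun j => hu' j n)

theorem exists_nhds_injOn_of_not_isTurningPt (hf : IsMultimodalPos f K I U) {y : ℝ} (hy : y ∈ U)
    (h : ¬ IsTurningPt f U y) : ∃ V ∈ 𝓝 y, InjOn f V := by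
  by_cases hd : deriv f y = 0
  · by_contra hV
    push Not at hV
    exact h ⟨⟨hy, hd⟩, hV⟩
  · exact exists_nhds_injOn_of_deriv_ne_zero (hf.contDiffAt hy) hd

/-! ### Finiteness of the points without neighbours in `K` -/

/-- Near any point of `K`, each of the two sides is an interval of injectivity, so it holds at most
one point of `B`; compactness concludes. -/
theorem finite_of_pairwise_not_injOn (hf : IsMultimodalPos f K I U) {ε : ℝ} (hε : 0 < ε)
    {B : Set ℝ} (hBK : B ⊆ K)
    (hB : ∀ x ∈ B, ∀ y ∈ B, x < y → y - x < ε → ¬ InjOn f (Icc x y)) : B.Finite := by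
  have key : (B ∩ K).Finite := by
    refine hf.isCompact.induction_on (p := fun s => (B ∩ s).Finite) (by simp)
      (fun s t hst ht => ht.subset (inter_subset_inter_right _ hst))
      (fun s t hs ht => by rw [inter_union_distrib_left]; exact hs.union ht) ?_
    intro c hc
    obtain ⟨η, hη, -, hl, hr⟩ := hf.exists_injOn_sides (hf.subset_dom' hc)
    have hsub : ∀ J : Set ℝ, J.OrdConnected → InjOn f J → (∀ x ∈ J, ∀ y ∈ J, y - x < ε) →
        (B ∩ J).Subsingleton := by
      intro J hJ hi hd x hx y hy
      by_contra hne
      rcases lt_or_gt_of_ne hne with h | h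
      · exact hB x hx.1 y hy.1 h (hd x hx.2 y hy.2) (hi.mono (hJ.out hx.2 hy.2))
      · exact hB y hy.1 x hx.1 h (hd y hy.2 x hx.2) (hi.mono (hJ.out hy.2 hx.2))
    set ρ := min η (ε / 2)
    have hρ0 : 0 < ρ := lt_min hη (by linarith)
    have h1 : ρ ≤ η := min_le_left _ _
    have h2 : ρ ≤ ε / 2 := min_le_right _ _
    refine ⟨Icc (c - ρ) (c + ρ), mem_nhdsWithin_of_mem_nhds
      (Icc_mem_nhds (by linarith) (by linarith)), ?_⟩
    have f1 := (hsub (Icc (c - ρ) c) ordConnected_Icc (hl.mono (Icc_subset_Icc_left (by linarith)))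
      fun x hx y hy => by linarith [hx.1, hy.2]).finite
    have f2 := (hsub (Icc c (c + ρ)) ordConnected_Icc (hr.mono (Icc_subset_Icc_right (by linarith)))
      fun x hx y hy => by linarith [hx.1, hy.2]).finite
    rw [← Icc_union_Icc_eq_Icc (b := c) (by linarith) (by linarith), inter_union_distrib_left]
    exact f1.union f2
  rwa [inter_eq_left.2 hBK] at key

/-- All but finitely many points of `K` have points of `K` nearby on either side, with `f`
injective in between. -/
theorem finite_not_exists_neighbours (hf : IsMultimodalPos f K I U) {ε : ℝ} (hε : 0 < ε) :
    {y ∈ K | ¬ ∃ p ∈ K, ∃ q ∈ K, p < y ∧ y < q ∧ y - p < ε ∧ q - y < ε ∧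
      InjOn f (Icc p y) ∧ InjOn f (Icc y q)}.Finite := by
  have h1 : {y ∈ K | ¬ ∃ p ∈ K, p < y ∧ y - p < ε ∧ InjOn f (Icc p y)}.Finite := by
    refine hf.finite_of_pairwise_not_injOn hε (fun y hy => hy.1) ?_
    exact fun x hx y hy hxy hd hi => hy.2 ⟨x, hx.1, hxy, hd, hi⟩
  have h2 : {y ∈ K | ¬ ∃ q ∈ K, y < q ∧ q - y < ε ∧ InjOn f (Icc y q)}.Finite := by
    refine hf.finite_of_pairwise_not_injOn hε (fun y hy => hy.1) ?_
    exact fun x hx y hy hxy hd hi => hx.2 ⟨y, hy.1, hxy, hd, hi⟩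
  refine (h1.union h2).subset ?_
  rintro y ⟨hy, hn⟩
  by_contra hcon
  simp only [mem_union, mem_ofPred_eq, hy, true_and, not_or, not_not] at hcon
  obtain ⟨⟨p, hp, a1, a2, a3⟩, q, hq, b1, b2, b3⟩ := hcon
  exact hn ⟨p, hp, q, hq, a1, b1, a2, b2, a3, b3⟩

/-- A repeated value would make `f` constant on an interval, which one-sided injectivity forbids. -/
theorem injOn_of_monotoneOn_or_antitoneOn (hf : IsMultimodalPos f K I U) {S : Set ℝ}
    (hS : S.OrdConnected) (hSU : S ⊆ U) (hm : MonotoneOn f S ∨ AntitoneOn f S) : InjOn f S := by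
  have key : ∀ x ∈ S, ∀ y ∈ S, x < y → f x ≠ f y := by
    intro x hx y hy hxy hfxy
    have hcst : ∀ t ∈ Icc x y, f t = f x := by
      intro t ht
      have htS := hS.out hx hy ht
      rcases hm with hm | hm
      · exact le_antisymm ((hm htS hy ht.2).trans hfxy.ge) (hm hx htS ht.1)
      · exact le_antisymm (hm hx htS ht.1) (hfxy.le.trans (hm htS hy ht.2))
    obtain ⟨η, hη, -, -, hi⟩ := hf.exists_injOn_sides (hSU hx)
    have hlt : x < min y (x + η) := lt_min hxy (by linarith)
    have := hi (left_mem_Icc.2 (by linarith)) ⟨hlt.le, min_le_right _ _⟩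
      (hcst _ ⟨hlt.le, min_le_left _ _⟩).symm
    exact hlt.ne this
  intro x hx y hy hxy
  by_contra hne
  rcases lt_or_gt_of_ne hne with h | h
  · exact key x hx y hy h hxy
  · exact key y hy x hx h hxy.symm

/-! ### Pullbacks along backward orbits -/

/-- Lifting at an arbitrary non-turning point: it needs the pullback at `f y` to be small, so the
admissible `r` depend on `y`. -/
theorem eventually_isPullback_step (hf : IsMultimodalPos f K I U) {ε a : ℝ} {v : ℝ → ℝ}
    (hε : 0 < ε) {y : ℝ} (hy : y ∈ K) (ht : ¬ IsTurningPt f U y)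
    (h : ∀ η > 0, ∀ᶠ r in 𝓝[>] (0 : ℝ),
      ∃ k w, IsPullback f K ε a (v r) k (f y) w ∧ |w - f y| < η) :
    ∀ η > 0, ∀ᶠ r in 𝓝[>] (0 : ℝ), ∃ k w, IsPullback f K ε a (v r) k y w ∧ |w - y| < η := by
  intro η hη
  obtain ⟨V, hV, hiV⟩ := hf.exists_nhds_injOn_of_not_isTurningPt (hf.subset_dom' hy) ht
  obtain ⟨θ, hθ, hU, hl, hr⟩ := hf.exists_injOn_sides (hf.subset_dom' hy)
  obtain ⟨e, he, heη⟩ := exists_between (lt_min (lt_min hη hε) hθ)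
  simp only [lt_min_iff] at heη
  obtain ⟨⟨he1, he2⟩, he3⟩ := heη
  have hl' : InjOn f (Icc (y - e) y) := hl.mono (Icc_subset_Icc_left (by linarith))
  have hr' : InjOn f (Icc y (y + e)) := hr.mono (Icc_subset_Icc_right (by linarith))
  have hc : ContinuousOn f (Icc (y - e) (y + e)) :=
    hf.continuousOn.mono ((Icc_subset_Icc (by linarith) (by linarith)).trans hU)
  have hpne : f (y - e) - f y ≠ 0 := fun hh => by
    have := hl' (left_mem_Icc.2 (by linarith)) (right_mem_Icc.2 (by linarith)) (sub_eq_zero.1 hh)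
    linarith
  have hqne : f (y + e) - f y ≠ 0 := fun hh => by
    have := hr' (right_mem_Icc.2 (by linarith)) (left_mem_Icc.2 (by linarith)) (sub_eq_zero.1 hh)
    linarith
  filter_upwards [h _ (lt_min (abs_pos.2 hpne) (abs_pos.2 hqne))] with r ⟨k, w', hpb, hw'⟩
  rw [lt_min_iff] at hw'
  obtain ⟨w, hw, rfl, hi⟩ := exists_preimage_segment (p := y - e) (q := y + e) (by linarith)
    (by linarith) hc hl' hr' hV hiV
    (fun hh => (abs_sub_left_of_mem_uIcc hh).not_gt hw'.1)
    (fun hh => (abs_sub_left_of_mem_uIcc hh).not_gt hw'.2)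
  have hwe : |w - y| ≤ e := abs_le.2 ⟨by linarith [hw.1], by linarith [hw.2]⟩
  refine ⟨k + 1, w, hpb.step hf.mapsTo hy (by linarith) (hc.mono ?_) hi, by linarith⟩
  exact ordConnected_Icc.uIcc_subset ⟨by linarith, by linarith⟩ hw

/-- Here `r` is not reduced: `f p` and `f q` lie in `K`, so the pullback at `f y` cannot reach them
and fits inside the image of one side. -/
theorem exists_isPullback_of_neighbours (hf : IsMultimodalPos f K I U) {ε a v : ℝ}
    (hεU : Metric.thickening ε K ⊆ U) {y : ℝ} (hy : y ∈ K) (ht : ¬ IsTurningPt f U y)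
    (hn : ∃ p ∈ K, ∃ q ∈ K, p < y ∧ y < q ∧ y - p < ε ∧ q - y < ε ∧
      InjOn f (Icc p y) ∧ InjOn f (Icc y q))
    (h : ∃ k w, IsPullback f K ε a v k (f y) w) : ∃ k w, IsPullback f K ε a v k y w := by
  obtain ⟨p, hp, q, hq, hpy, hyq, hp', hq', hip, hiq⟩ := hn
  obtain ⟨k, w', hpb⟩ := h
  obtain ⟨V, hV, hiV⟩ := hf.exists_nhds_injOn_of_not_isTurningPt (hf.subset_dom' hy) ht
  have hc : ContinuousOn f (Icc p q) := by
    refine hf.continuousOn.mono fun z hz => hεU (Metric.mem_thickening_iff.2 ⟨y, hy, ?_⟩)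
    rw [Real.dist_eq, abs_lt]
    exact ⟨by linarith [hz.1], by linarith [hz.2]⟩
  obtain ⟨w, hw, rfl, hi⟩ := exists_preimage_segment hpy hyq hc hip hiq hV hiV
    (fun hh => hpy.ne (hip (left_mem_Icc.2 hpy.le) (right_mem_Icc.2 hpy.le)
      (hpb.2.2.2.2 _ hh (hf.mapsTo hp))))
    (fun hh => hyq.ne' (hiq (right_mem_Icc.2 hyq.le) (left_mem_Icc.2 hyq.le)
      (hpb.2.2.2.2 _ hh (hf.mapsTo hq))))
  refine ⟨k + 1, w, hpb.step hf.mapsTo hy ?_ (hc.mono ?_) hi⟩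
  · exact abs_lt.2 ⟨by linarith [hw.1], by linarith [hw.2]⟩
  · exact ordConnected_Icc.uIcc_subset ⟨hpy.le, hyq.le⟩ hw

/-- The points with a pullback of one and the same short segment at `a` are dense in `K`, unless
`a` is exceptional. -/
theorem eventually_subset_closure_isPullback (hf : IsMultimodalPos f K I U) {ε a : ℝ} {v : ℝ → ℝ}
    (hε : 0 < ε) (hεU : Metric.thickening ε K ⊆ U) (ha : a ∈ K)
    (hex : ¬ IsWeaklyExceptional f K {c | c ∈ K ∧ IsTurningPt f U c} a)
    (hv : ∀ η > 0, ∀ᶠ r in 𝓝[>] (0 : ℝ), IsPullback f K ε a (v r) 0 a (v r) ∧ |v r - a| < η) :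
    ∀ᶠ r in 𝓝[>] (0 : ℝ), K ⊆ closure {y | y ∈ K ∧ ∃ k w, IsPullback f K ε a (v r) k y w} := by
  set Q : ℝ → Prop := fun y => ∀ η > 0, ∀ᶠ r in 𝓝[>] (0 : ℝ),
    ∃ k w, IsPullback f K ε a (v r) k y w ∧ |w - y| < η
  have hQa : Q a := fun η hη => (hv η hη).mono fun r hr => ⟨0, v r, hr⟩
  -- Finitely many points lack neighbours, so a single `r` serves all those that satisfy `Q`.
  have hbad := (eventually_all_finite (hf.finite_not_exists_neighbours hε)).2
    (fun y _ => show ∀ᶠ r in 𝓝[>] (0 : ℝ), Q y → ∃ k w, IsPullback f K ε a (v r) k y w by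
      by_cases hy : Q y
      · exact (hy 1 one_pos).mono fun r ⟨k, w, h, _⟩ _ => ⟨k, w, h⟩
      · exact Eventually.of_forall fun r h => absurd h hy)
  filter_upwards [hbad, hv 1 one_pos] with r hr hra
  -- `Q` is kept alongside the pullback for the fixed `r`, since it is what handles a preimage
  -- lacking neighbours.
  set E : Set ℝ := {y | y ∈ K ∧ Q y ∧ ∃ k w, IsPullback f K ε a (v r) k y w}
  have haE : a ∈ E := ⟨ha, hQa, 0, v r, hra.1⟩
  by_contra hcon
  refine hex ⟨E, ⟨⟨a, haE⟩, fun y hy => hy.1, fun hKE => hcon (hKE.trans (closure_mono ?_)), ?_⟩, haE⟩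
  · exact fun y hy => ⟨hy.1, hy.2.2⟩
  · rintro y ⟨⟨hyK, -, hyQ, hyw⟩, hyt⟩
    have ht : ¬ IsTurningPt f U y := fun h => hyt ⟨hyK, h⟩
    have hQy : Q y := hf.eventually_isPullback_step hε hyK ht hyQ
    refine ⟨hyK, hQy, ?_⟩
    by_cases hn : ∃ p ∈ K, ∃ q ∈ K, p < y ∧ y < q ∧ y - p < ε ∧ q - y < ε ∧
        InjOn f (Icc p y) ∧ InjOn f (Icc y q)
    · exact hf.exists_isPullback_of_neighbours hεU hyK ht hn hyw
    · exact hr y ⟨hyK, hn⟩ hQy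

/-! ### The periodic orbit contradicting weak isolation -/

theorem exists_forall_map_notMem (hf : IsMultimodalPos f K I U) (hK : WeaklyIsolated f K U)
    {a : ℝ} (ha : a ∈ K) {s : ℝ} (hs : s = 1 ∨ s = -1)
    (hex : ¬ IsWeaklyExceptional f K {c | c ∈ K ∧ IsTurningPt f U c} a) :
    ∃ δ > 0, ∀ x, 0 < s * (x - a) → s * (x - a) < δ →
      (∀ t, 0 < s * (t - a) → s * (t - a) ≤ s * (x - a) → t ∉ I) →
      InjOn f (uIcc a x) → f x ∉ K := by
  by_contra! H
  obtain ⟨ε₀, hε₀, hper⟩ := hK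
  obtain ⟨ε₁, hε₁, hU₁⟩ := hf.isCompact.exists_thickening_subset_open hf.isOpen_dom hf.subset_dom'
  set ε := min ε₀ ε₁
  have hε : 0 < ε := lt_min hε₀ hε₁
  have hεU : Metric.thickening ε K ⊆ U :=
    (Metric.thickening_mono (min_le_right _ _) K).trans hU₁
  have hε0 : Metric.thickening ε K ⊆ Metric.thickening ε₀ K :=
    Metric.thickening_mono (min_le_left _ _) K
  have hss : s * s = 1 := by rcases hs with rfl | rfl <;> norm_num
  have habs : ∀ t, |t - a| = |s * (t - a)| := fun t => by
    rcases hs with rfl | rfl <;> simp [abs_sub_comm]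
  have hseg : ∀ x t, 0 < s * (x - a) →
      (t ∈ uIcc a x ↔ 0 ≤ s * (t - a) ∧ s * (t - a) ≤ s * (x - a)) := by
    intro x t hx
    rw [mem_uIcc]
    rcases hs with rfl | rfl
    · constructor
      · rintro (h | h) <;> constructor <;> linarith
      · rintro ⟨h1, h2⟩; left; constructor <;> linarith
    · constructor
      · rintro (h | h) <;> constructor <;> linarith
      · rintro ⟨h1, h2⟩; right; constructor <;> linarith
  have hne : ∀ t, 0 ≤ s * (t - a) → t ≠ a → 0 < s * (t - a) := by
    intro t h0 hta
    refine h0.lt_of_ne' (mul_ne_zero ?_ (sub_ne_zero.2 hta))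
    rintro rfl
    norm_num at hss
  -- This first point only provides a gap of `I` beside `a`, in which the initial segments are
  -- taken.
  obtain ⟨x₀, hx₀, -, hx₀I, -⟩ := H 1 one_pos
  have hv : ∀ η > 0, ∀ᶠ r in 𝓝[>] (0 : ℝ),
      IsPullback f K ε a (a + s * r) 0 a (a + s * r) ∧ |a + s * r - a| < η := by
    intro η hη
    filter_upwards [Ioo_mem_nhdsGT (lt_min (lt_min hη hε) hx₀)] with r hr
    obtain ⟨hr0, hr1⟩ := hr
    simp only [lt_min_iff] at hr1
    have e1 : s * (a + s * r - a) = r := by linear_combination r * hss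
    have e2 : |a + s * r - a| = r := by rw [habs, e1, abs_of_pos hr0]
    refine ⟨IsPullback.refl ha (by linarith) fun z hz hzK => ?_, by linarith⟩
    by_contra hza
    rw [hseg _ _ (by linarith), e1] at hz
    exact hx₀I z (hne z hz.1 hza) (by linarith) (hf.subset hzK)
  obtain ⟨r, hdense, hr⟩ := ((hf.eventually_subset_closure_isPullback hε hεU ha hex hv).and
    (Ioo_mem_nhdsGT hε)).exists
  obtain ⟨hr0, hrε⟩ := hr
  -- `x` is taken closer to `a` than `r`, so that the segment pulled back extends beyond `x`; `x'`,
  -- closer still, puts a point of `K` strictly between `f a` and `f x`.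
  obtain ⟨x, hx, hxr, hxI, hxi, hfx⟩ := H r hr0
  obtain ⟨x', hx', hxx', -, -, hfx'⟩ := H _ hx
  have hxε : |x - a| < ε := by rw [habs, abs_of_pos hx]; linarith
  have hc : ContinuousOn f (uIcc a x) :=
    hf.continuousOn.mono fun z hz => hεU (mem_thickening_of_mem_uIcc ha hxε hz)
  have hxm : x' ∈ uIcc a x := (hseg _ _ hx).2 ⟨hx'.le, hxx'.le⟩
  have hend : ∀ z ∈ uIcc (f a) (f x), z ≠ f a → z ≠ f x →
      z ∈ Ioo (min (f a) (f x)) (max (f a) (f x)) := by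
    intro z hz h1 h2
    refine ⟨lt_of_le_of_ne hz.1 fun h => ?_, lt_of_le_of_ne hz.2 fun h => ?_⟩
    · rcases min_choice (f a) (f x) with h' | h' <;> rw [h'] at h
      exacts [h1 h.symm, h2 h.symm]
    · rcases max_choice (f a) (f x) with h' | h' <;> rw [h'] at h
      exacts [h1 h, h2 h]
  have hO := hend (f x') (mapsTo_uIcc_of_injOn hc hxi hxm)
    (fun h => by
      rw [hxi hxm left_mem_uIcc h] at hx'
      simp at hx')
    (fun h => by
      rw [hxi hxm right_mem_uIcc h] at hxx'
      exact hxx'.false)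
  obtain ⟨y, hyO, hyK, k, w, hpb⟩ := mem_closure_iff.1 (hdense hfx') _ isOpen_Ioo hO
  obtain ⟨hk1, hk2, hk3, hk4, hk5⟩ := hpb
  have hmin : min (f a) (f x) ∈ K := by
    rcases min_choice (f a) (f x) with h' | h' <;> rw [h']
    exacts [hf.mapsTo ha, hfx]
  have hmax : max (f a) (f x) ∈ K := by
    rcases max_choice (f a) (f x) with h' | h' <;> rw [h']
    exacts [hf.mapsTo ha, hfx]
  -- Otherwise the pullback would contain `f a` or `f x`, a point of `K` other than its start `y`.
  have hwO : w ∈ uIcc (f a) (f x) := by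
    constructor
    · by_contra! hlt
      exact hyO.1.ne (hk5 _ (mem_uIcc.2 (Or.inr ⟨hlt.le, hyO.1.le⟩)) hmin)
    · by_contra! hlt
      exact hyO.2.ne' (hk5 _ (mem_uIcc.2 (Or.inl ⟨hyO.2.le, hlt.le⟩)) hmax)
  obtain ⟨y', hy', rfl⟩ := intermediate_value_uIcc hc ⟨hyO.1.le, hyO.2.le⟩
  obtain ⟨w', hw', rfl⟩ := intermediate_value_uIcc hc hwO
  have hsub : uIcc y' w' ⊆ uIcc a x := ordConnected_uIcc.uIcc_subset hy' hw'
  have hm := mapsTo_uIcc_of_injOn (hc.mono hsub) (hxi.mono hsub)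
  have hck : ContinuousOn (fun t => f^[k + 1] t - t) (uIcc y' w') := by
    refine ContinuousOn.sub ?_ continuousOn_id
    rw [Function.iterate_succ]
    exact hk3.comp (hc.mono hsub) hm
  -- The iterate sends `y'` back to `a` and `w'` to `a + s * r`, beyond `x`, so the displacement
  -- changes sign.
  obtain ⟨p, hp, hp0⟩ : (0 : ℝ) ∈ (fun t => f^[k + 1] t - t) '' uIcc y' w' := by
    refine intermediate_value_uIcc hck ?_
    simp only [Function.iterate_succ_apply, hk1, hk2]
    rw [hseg _ _ hx] at hy' hw'
    rw [mem_uIcc]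
    rcases hs with rfl | rfl
    · left; constructor <;> linarith
    · right; constructor <;> linarith
  have hpp : f^[k + 1] p = p := sub_eq_zero.1 hp0
  have hpa : p ≠ a := by
    rintro rfl
    have h1 := hk5 _ (hm hp) (hf.mapsTo ha)
    rcases min_choice (f p) (f x) with h' | h'
    · rw [h', ← h1] at hyO
      exact hyO.1.false
    · rw [max_eq_left (min_eq_right_iff.1 h'), ← h1] at hyO
      exact hyO.2.false
  have hpm := (hseg _ _ hx).1 (hsub hp)
  refine hxI p (hne p hpm.1 hpa) hpm.2 (hf.subset (hper p (k + 1) k.succ_pos hpp ?_ 0))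
  intro i
  suffices h : f^[i] p ∈ Metric.thickening ε K from ⟨hεU h, hε0 h⟩
  -- The pullback controls the orbit for one period only.
  have hmod : f^[i % (k + 1)] p = f^[i] p :=
    Function.IsPeriodicPt.iterate_mod_apply (show Function.IsPeriodicPt f (k + 1) p from hpp) i
  rw [← hmod]
  have hlt := Nat.mod_lt i k.succ_pos
  cases h : i % (k + 1) with
  | zero => exact mem_thickening_of_mem_uIcc ha hxε (hsub hp)
  | succ j => exact hk4 _ (hm hp) j (by rw [h, Nat.succ_eq_add_one] at hlt; omega)

/-! ### Monotone intervals and ends of `I` -/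

theorem isEmbedding_domRestrict (hf : IsMultimodalPos f K I U) {W : Set ℝ} (hW : W.OrdConnected)
    (hWU : W ⊆ U) (hm : MonotoneOn f W ∨ AntitoneOn f W) :
    Topology.IsEmbedding (W.domRestrict f) := by
  have hc : ContinuousOn f W := hf.continuousOn.mono hWU
  have hi := hf.injOn_of_monotoneOn_or_antitoneOn hW hWU hm
  have key : ∀ g : ℝ → ℝ, ContinuousOn g W → InjOn g W → MonotoneOn g W →
      Topology.IsEmbedding (W.domRestrict g) := by
    intro g hg hgi hgm
    have hs : StrictMono (W.domRestrict g) := fun x y hxy =>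
      lt_of_le_of_ne (hgm x.2 y.2 hxy.le) fun h => hxy.ne (Subtype.ext (hgi x.2 y.2 h))
    refine hs.isEmbedding_of_ordConnected ?_
    rw [range_domRestrict]
    exact (hW.isPreconnected.image g hg).ordConnected
  rcases hm with hm | hm
  · exact key f hc hi hm
  · have := key (fun x => -f x) hc.neg (fun x hx y hy h => hi hx hy (neg_injective h)) hm.neg
    convert (Homeomorph.neg ℝ).isEmbedding.comp this using 1
    ext x
    simp [Set.domRestrict]

/-- `f` remains injective when an end of the domain is added to an interval where it is. -/
theorem injOn_insert_of_endpoint (hf : IsMultimodalPos f K I U) {W : Set ℝ} (hi : InjOn f W)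
    {a x s : ℝ} (hs : s = 1 ∨ s = -1) (ha : a ∈ U) (hWU : W ⊆ U)
    (hW : ∀ t, 0 < s * (t - a) → s * (t - a) ≤ s * (x - a) → t ∈ W) (hx : 0 < s * (x - a)) :
    InjOn f (uIcc a x) := by
  have hseg : ∀ t ∈ uIcc a x, t ≠ a → t ∈ W := by
    intro t ht hta
    rw [mem_uIcc] at ht
    rcases hs with rfl | rfl
    · rcases ht with ht | ht
      · have := lt_of_le_of_ne ht.1 (Ne.symm hta)
        exact hW t (by linarith) (by linarith)
      · linarith
    · rcases ht with ht | ht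
      · linarith
      · have := lt_of_le_of_ne ht.2 hta
        exact hW t (by linarith) (by linarith)
  have key : ∀ t ∈ uIcc a x, t ≠ a → f t ≠ f a := by
    intro t ht hta hft
    have hsub : uIcc a t ⊆ uIcc a x := uIcc_subset_uIcc_left ht
    have hU : uIcc a t ⊆ U := fun z hz => by
      by_cases hza : z = a
      · exact hza ▸ ha
      · exact hWU (hseg z (hsub hz) hza)
    have hc := hf.continuousOn.mono hU
    -- the value halfway between those at the midpoint and at the ends is taken on both halves
    set u := (a + t) / 2 with hu
    have hau : a ≠ u := fun h => hta (by linarith)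
    have hut : u ≠ t := fun h => hta (by linarith)
    have hum : u ∈ uIcc a t := by
      rw [mem_uIcc]
      rcases le_total a t with h | h
      · left; constructor <;> linarith
      · right; constructor <;> linarith
    have hfu : f u ≠ f t := fun h => hut (hi (hseg u (hsub hum) hau.symm) (hseg t ht hta) h)
    have h1 : uIcc a u ⊆ uIcc a t := uIcc_subset_uIcc_left hum
    have h2 : uIcc u t ⊆ uIcc a t := uIcc_subset_uIcc_right hum
    set m := (f u + f t) / 2 with hm
    have hmm : m ∈ uIcc (f u) (f t) := by
      rw [mem_uIcc]
      rcases le_total (f u) (f t) with h | h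
      · left; constructor <;> linarith
      · right; constructor <;> linarith
    obtain ⟨z₂, hz₂, hfz₂⟩ := intermediate_value_uIcc (hc.mono h2) hmm
    rw [hft, uIcc_comm] at hmm
    obtain ⟨z₁, hz₁, hfz₁⟩ := intermediate_value_uIcc (hc.mono h1) hmm
    have hmu : m ≠ f u := fun h => hfu (by linarith)
    have hmt : m ≠ f t := fun h => hfu (by linarith)
    have hz1a : z₁ ≠ a := by rintro rfl; exact hmt (hfz₁.symm.trans hft.symm)
    have hz2a : z₂ ≠ a := by rintro rfl; exact hmt (hfz₂.symm.trans hft.symm)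
    have heq := hi (hseg _ (hsub (h1 hz₁)) hz1a) (hseg _ (hsub (h2 hz₂)) hz2a)
      (hfz₁.trans hfz₂.symm)
    rw [← heq] at hz₂
    have : z₁ = u := by
      rw [mem_uIcc] at hz₁ hz₂
      rcases hz₁ with h | h <;> rcases hz₂ with h' | h' <;> linarith
    rw [this] at hfz₁
    exact hmu hfz₁.symm
  intro p hp q hq hpq
  by_cases hpa : p = a
  · by_contra hne
    exact key q hq (fun h => hne (hpa.trans h.symm)) (hpa ▸ hpq.symm)
  · by_cases hqa : q = a
    · exact absurd (hqa ▸ hpq) (key p hp hpa)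
    · exact hi (hseg p hp hpa) (hseg q hq hqa) hpq

/-- Leaving `I`, one passes through an end of one of its intervals. -/
theorem exists_endpoint (hf : IsMultimodalPos f K I U) {z x : ℝ} (hz : z ∈ I) (hx : x ∉ I) :
    ∃ a s : ℝ, (s = 1 ∨ s = -1) ∧ a ∈ K ∧ 0 < s * (x - a) ∧
      (∀ t, 0 < s * (t - a) → s * (t - a) ≤ s * (x - a) → t ∉ I ∧ t ∈ uIcc z x ∧ t ≠ z) := by
  obtain ⟨m, l, r, hlr, -, hI, hlrK⟩ := hf.exists_intervals
  rcases lt_or_gt_of_ne (fun h => hx (h ▸ hz) : z ≠ x) with h | h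
  -- `a` is the last point of `I` before `x`; it ends its component, which would otherwise continue
  -- into the gap.
  · obtain ⟨a, ⟨haI, haz⟩, hmax⟩ := (hf.isCompact_intervals.inter_right isClosed_Icc
      (t := Icc z x)).exists_isGreatest ⟨z, hz, left_mem_Icc.2 h.le⟩
    have hax : a < x := lt_of_le_of_ne haz.2 fun h => hx (h ▸ haI)
    have hgap : ∀ t, a < t → t ≤ x → t ∉ I := fun t h1 h2 ht =>
      (hmax ⟨ht, haz.1.trans h1.le, h2⟩).not_gt h1
    refine ⟨a, 1, Or.inl rfl, ?_, by linarith, fun t h1 h2 => ?_⟩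
    · rw [hI, mem_iUnion] at haI
      obtain ⟨j, hj⟩ := haI
      suffices a = r j from this ▸ (hlrK j).2
      by_contra hne
      obtain ⟨t, ht1, ht2⟩ := exists_between (lt_min (lt_of_le_of_ne hj.2 hne) hax)
      rw [lt_min_iff] at ht2
      refine hgap t ht1 ht2.2.le ?_
      rw [hI, mem_iUnion]
      exact ⟨j, hj.1.trans ht1.le, ht2.1.le⟩
    · exact ⟨hgap t (by linarith) (by linarith),
        Icc_subset_uIcc ⟨by linarith [haz.1], by linarith⟩, by linarith [haz.1]⟩
  · obtain ⟨a, ⟨haI, haz⟩, hmin⟩ := (hf.isCompact_intervals.inter_right isClosed_Icc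
      (t := Icc x z)).exists_isLeast ⟨z, hz, right_mem_Icc.2 h.le⟩
    have hax : x < a := lt_of_le_of_ne haz.1 fun h => hx (h ▸ haI)
    have hgap : ∀ t, t < a → x ≤ t → t ∉ I := fun t h1 h2 ht =>
      (hmin ⟨ht, h2, h1.le.trans haz.2⟩).not_gt h1
    refine ⟨a, -1, Or.inr rfl, ?_, by linarith, fun t h1 h2 => ?_⟩
    · rw [hI, mem_iUnion] at haI
      obtain ⟨j, hj⟩ := haI
      suffices l j = a from this ▸ (hlrK j).1
      by_contra hne
      obtain ⟨t, ht2, ht1⟩ := exists_between (max_lt (lt_of_le_of_ne hj.1 hne) hax)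
      rw [max_lt_iff] at ht2
      refine hgap t ht1 ht2.2.le ?_
      rw [hI, mem_iUnion]
      exact ⟨j, ht2.1.le, ht1.le.trans hj.2⟩
    · exact ⟨hgap t (by linarith) (by linarith),
        Icc_subset_uIcc' ⟨by linarith, by linarith [haz.2]⟩, by linarith [haz.2]⟩

theorem mem_closure_of_endpoint {T : Set ℝ} {a x s : ℝ} (hs : s = 1 ∨ s = -1)
    (hx : 0 < s * (x - a)) (hT : ∀ t, 0 < s * (t - a) → s * (t - a) ≤ s * (x - a) → t ∈ T) :
    a ∈ closure T := by
  rcases hs with rfl | rfl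
  · have hax : a < x := by linarith
    have hsub : Ioc a x ⊆ T := fun t ht => hT t (by linarith [ht.1]) (by linarith [ht.2])
    refine closure_mono hsub ?_
    rw [closure_Ioc hax.ne]
    exact left_mem_Icc.2 hax.le
  · have hax : x < a := by linarith
    have hsub : Ico x a ⊆ T := fun t ht => hT t (by linarith [ht.2]) (by linarith [ht.1])
    refine closure_mono hsub ?_
    rw [closure_Ico hax.ne]
    exact right_mem_Icc.2 hax.le

/-- The set of ends of the intervals of `I` is finite. -/
theorem finite_frontier (hf : IsMultimodalPos f K I U) : (frontier I).Finite := by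
  obtain ⟨m, l, r, hlr, -, hI, -⟩ := hf.exists_intervals
  refine ((finite_range l).union (finite_range r)).subset fun a ha => ?_
  have haI := hf.isCompact_intervals.isClosed.frontier_subset ha
  rw [hI, mem_iUnion] at haI
  obtain ⟨j, hj⟩ := haI
  by_contra hcon
  simp only [mem_union, mem_range, not_or, not_exists] at hcon
  refine ha.2 (mem_interior.2 ⟨Ioo (l j) (r j), ?_, isOpen_Ioo,
    lt_of_le_of_ne hj.1 (hcon.1 j), lt_of_le_of_ne hj.2 (Ne.symm (hcon.2 j))⟩)
  rw [hI]
  exact Ioo_subset_Icc_self.trans (subset_iUnion (fun j => Icc (l j) (r j)) j)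

/-! ### A uniform constant and the conclusion -/

theorem exists_uniform_forall_map_notMem (hf : IsMultimodalPos f K I U)
    (hK : WeaklyIsolated f K U) :
    ∃ δ > 0, ∀ a ∈ frontier I, a ∈ K → ∀ s : ℝ, (s = 1 ∨ s = -1) →
      ¬ IsWeaklyExceptional f K {c | c ∈ K ∧ IsTurningPt f U c} a →
      ∀ x, 0 < s * (x - a) → s * (x - a) < δ →
        (∀ t, 0 < s * (t - a) → s * (t - a) ≤ s * (x - a) → t ∉ I) →
        InjOn f (uIcc a x) → f x ∉ K := by
  have h : ∀ᶠ δ in 𝓝[>] (0 : ℝ), ∀ a ∈ frontier I, ∀ s ∈ ({1, -1} : Set ℝ), a ∈ K →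
      ¬ IsWeaklyExceptional f K {c | c ∈ K ∧ IsTurningPt f U c} a →
      ∀ x, 0 < s * (x - a) → s * (x - a) < δ →
        (∀ t, 0 < s * (t - a) → s * (t - a) ≤ s * (x - a) → t ∉ I) →
        InjOn f (uIcc a x) → f x ∉ K := by
    -- There are finitely many ends and two sides, so the constants for each can be shrunk to a
    -- common one.
    refine (eventually_all_finite hf.finite_frontier).2 fun a _ =>
      (eventually_all_finite (Set.toFinite _)).2 fun s hs => ?_
    by_cases hcond : a ∈ K ∧ ¬ IsWeaklyExceptional f K {c | c ∈ K ∧ IsTurningPt f U c} a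
    · obtain ⟨δ, hδ, hd⟩ := hf.exists_forall_map_notMem hK hcond.1 hs hcond.2
      filter_upwards [Ioo_mem_nhdsGT hδ] with δ' hδ' _ _ x h1 h2
      exact hd x h1 (h2.trans hδ'.2)
    · exact Eventually.of_forall fun δ h1 h2 => absurd ⟨h1, h2⟩ hcond
  obtain ⟨δ, hδ, hδ0⟩ := (h.and self_mem_nhdsWithin).exists
  exact ⟨δ, hδ0, fun a ha haK s hs hex => hδ a ha s hs haK hex⟩

end IsMultimodalPos

theorem mainTheorem8 (f : ℝ → ℝ) (K I U : Set ℝ) (hf : IsMultimodalPos f K I U)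
    (hK : WeaklyIsolated f K U) :
    ∃ δ > 0, ∀ W : Set ℝ, W.OrdConnected → W ⊆ U → (∀ x ∈ W, ∀ y ∈ W, |x - y| < δ) →
      (MonotoneOn f W ∨ AntitoneOn f W) → (closure W ∩ K).Nonempty →
      (∀ x ∈ closure W ∩ frontier I, ¬ IsWeaklyExceptional f K {c | c ∈ K ∧ IsTurningPt f U c} x) →
      IsKHomeo f K W := by
  obtain ⟨δ, hδ, hd⟩ := hf.exists_uniform_forall_map_notMem hK
  refine ⟨δ / 2, half_pos hδ, fun W hW hWU hdiam hm ⟨z, hzW, hzK⟩ hex =>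
    ⟨hf.isEmbedding_domRestrict hW hWU hm, Subset.antisymm ?_ ?_⟩⟩
  · rintro _ ⟨x, ⟨hxW, hxK⟩, rfl⟩
    exact ⟨⟨x, hxW, rfl⟩, hf.mapsTo hxK⟩
  rintro _ ⟨⟨x, hxW, rfl⟩, hfx⟩
  refine ⟨x, ⟨hxW, ?_⟩, rfl⟩
  by_cases hxI : x ∈ I
  · exact hf.mem_of_mem_of_map_mem hxI hfx
  exfalso
  obtain ⟨a, s, hs, haK, hxa, hgap⟩ := hf.exists_endpoint (hf.subset hzK) hxI
  have hWseg : ∀ t ∈ uIcc z x, t ≠ z → t ∈ W := by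
    intro t ht htz
    rw [mem_uIcc] at ht
    rcases ht with ht | ht
    · obtain ⟨u, hu, huW⟩ := mem_closure_iff.1 hzW (Iio t) isOpen_Iio
        (lt_of_le_of_ne ht.1 (Ne.symm htz))
      exact hW.out huW hxW ⟨le_of_lt hu, ht.2⟩
    · obtain ⟨u, hu, huW⟩ := mem_closure_iff.1 hzW (Ioi t) isOpen_Ioi (lt_of_le_of_ne ht.2 htz)
      exact hW.out hxW huW ⟨ht.1, le_of_lt hu⟩
  have hT : ∀ t, 0 < s * (t - a) → s * (t - a) ≤ s * (x - a) → t ∈ W := fun t h1 h2 =>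
    hWseg t (hgap t h1 h2).2.1 (hgap t h1 h2).2.2
  have haW : a ∈ closure W := IsMultimodalPos.mem_closure_of_endpoint hs hxa hT
  have haF : a ∈ frontier I := by
    rw [frontier_eq_closure_inter_closure]
    exact ⟨subset_closure (hf.subset haK), IsMultimodalPos.mem_closure_of_endpoint hs hxa
      fun t h1 h2 => (hgap t h1 h2).1⟩
  -- The end `a` may lie outside `W`, so the bound on `W` is tested at the point at distance `δ / 2`
  -- from `x` towards `a`, which would lie in `W`.
  have hlt : s * (x - a) < δ := by
    by_contra! hge
    have hss : s * s = 1 := by rcases hs with rfl | rfl <;> norm_num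
    have e : s * (x - s * (δ / 2) - a) = s * (x - a) - δ / 2 := by
      linear_combination (-(δ / 2)) * hss
    have := hdiam x hxW _ (hT (x - s * (δ / 2)) (by linarith) (by linarith))
    rw [sub_sub_cancel, abs_mul, abs_of_pos (half_pos hδ)] at this
    rcases hs with rfl | rfl <;> simp at this
  exact hd a haF haK s hs (hex a ⟨haW, haF⟩) x hxa hlt (fun t h1 h2 => (hgap t h1 h2).1)
    (hf.injOn_insert_of_endpoint (hf.injOn_of_monotoneOn_or_antitoneOn hW hWU hm) hs
      (hf.subset_dom' haK) hWU hT hxa) hfx
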